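/- Let $X$ be a set of agents, let $c : X\times X\to[0,\infty)$ be a cost function, let $\mathcal H\subseteq\{0,1\}^X$, and let $V=\{h_1,\dots,h_n\}\subseteq\mathcal H$ consist of $n$ distinct classifiers. For $x\in X$ and $S\subseteq V$ put $$c(x,S)=\min\{c(x,z) : z\in X,\ h'(z)=1 \text{ for all } h'\in S\}.$$ The cost function $c$ is called $V$-submodular if, for every $x\in X$, this minimum exists for every $S\subseteq V$ and $$c(x,S\cup\{h'\})-c(x,S)\ \ge\ c(x,S'\cup\{h'\})-c(x,S')\qquad\text{whenever } S\subseteq S'\subseteq V,\ h'\in V\setminus S'.$$ For a probability distribution $P$ on $V$ put $g_x(S)=\sum_{h'\in S}P(h')-c(x,S)$. The projection oracle for an agent $x$ takes index sets $I^+,I^-\subseteq\{1,\dots,n\}$ and returns a point $z$ minimizing $c(x,z)$ over the region $\{z : h_i(z)=1\ \forall i\in I^+,\ h_i(z)=0\ \forall i\in I^-\}$ (an arbitrary point if there is no minimizer). **Theorem.** There are absolute constants $C>0$ and $k\in\mathbb N$ and a randomized algorithm that takes as input $n$, $P$, $\epsilon$ and $\delta$, and that has access to $X$, $x$, $c$ and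 $V$ only through adaptive calls to the projection oracle for $x$, of which it sees the cost $c(x,z)$ of the returned point $z$, such that the following holds. For all $X$, $c$, $\mathcal H$, $V$, $P$ as above with $c$ $V$-submodular, every agent $x\in X$, every $\epsilon>0$ and every $\delta\in(0,1)$, the algorithm always makes at most $$C\cdot\frac{n}{\epsilon^2}\cdot\log^k\!\Big(2+\frac n\epsilon\Big)\cdot\log\frac2\delta\ =\ \tilde O(n/\epsilon^2)$$ oracle calls, and with probability at least $1-\delta$ it outputs a set $\hat S\subseteq V$ with $$g_x(\hat S)\ \ge\ \max_{S\subseteq V} g_x(S)-\epsilon .$$ -/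

import Mathlib

universe u

namespace StrategicOracle

/-- A binary classifier on the space `X` of agents; `h z = true` means that `z` passes `h`. -/
abbrev Classifier (X : Type u) : Type u := X → Bool

/-- The region `R⁺ ∩ R⁻`: the points that pass every `h i` with `i ∈ I` and fail every `h i` with
`i ∈ J`. -/
def region {X : Type u} {n : ℕ} (h : Fin n → Classifier X) (I J : Finset (Fin n)) : Set X :=
  {z | (∀ i ∈ I, h i z = true) ∧ (∀ i ∈ J, h i z = false)}

/-- `z` is a cheapest point of `R` for the agent `x`, i.e. `z ∈ argmin_{z ∈ R} c x z`. -/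
def IsProjection {X : Type u} (c : X → X → ℝ) (x : X) (R : Set X) (z : X) : Prop :=
  z ∈ R ∧ ∀ z' ∈ R, c x z ≤ c x z'

/-- The induced cost `c(x, S)`: the least cost that the agent `x` incurs to pass every classifier
in `S`. (It is a genuine minimum wherever it is used, see the first half of `IsVSubmodular`.) -/
noncomputable def inducedCost {X : Type u} {n : ℕ} (c : X → X → ℝ) (h : Fin n → Classifier X)
    (x : X) (S : Finset (Fin n)) : ℝ :=
  sInf (c x '' region h S ∅)

/-- `V`-submodularity for `V = {h 0, …, h (n - 1)}`, subsets of `V` being given by their index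
sets: for every agent `x` the minimum that defines `c(x, S)` exists for every `S ⊆ V`, so that
`c(x, ·)` is a well defined real-valued set function, and this set function is submodular. -/
def IsVSubmodular {X : Type u} {n : ℕ} (c : X → X → ℝ) (h : Fin n → Classifier X) : Prop :=
  ∀ x : X,
    (∀ S : Finset (Fin n), ∃ z, IsProjection c x (region h S ∅) z) ∧
    ∀ S S' : Finset (Fin n), S ⊆ S' → ∀ i, i ∉ S' →
      inducedCost c h x (insert i S') - inducedCost c h x S' ≤
        inducedCost c h x (insert i S) - inducedCost c h x S

/-- The objective `g_x(S) = ∑_{h' ∈ S} P(h') - c(x, S)`. -/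
noncomputable def objective {X : Type u} {n : ℕ} (P : Fin n → ℝ) (c : X → X → ℝ)
    (h : Fin n → Classifier X) (x : X) (S : Finset (Fin n)) : ℝ :=
  ∑ i ∈ S, P i - inducedCost c h x S

/-- `O` is a correct projection oracle for the agent `x`: on the region given by `I` and `J` it
returns a cheapest point, whenever there is one (otherwise its answer is unconstrained). -/
def IsOracle {X : Type u} {n : ℕ} (c : X → X → ℝ) (h : Fin n → Classifier X) (x : X)
    (O : Finset (Fin n) → Finset (Fin n) → X) : Prop :=
  ∀ I J, (∃ z, IsProjection c x (region h I J) z) → IsProjection c x (region h I J) (O I J)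

/-- A deterministic adaptive algorithm with access to the projection oracle, as a decision tree:
it either stops and outputs a subset of `{h 0, …, h (n - 1)}`, or queries the oracle on the region
given by `I` and `J` and continues depending on the cost of the point that the oracle returns.
The space of agents, the agent, the cost function and the classifiers are not visible to it
in any other way. -/
inductive OracleAlg (n : ℕ) : Type
  | output (S : Finset (Fin n)) : OracleAlg n
  | query (I J : Finset (Fin n)) (next : ℝ → OracleAlg n) : OracleAlg n

namespace OracleAlg

/-- The set that the algorithm outputs when it is run with the oracle `O` and with the cost
function `cost` of the agent (`cost z = c x z`). -/
def run {X : Type u} {n : ℕ} (O : Finset (Fin n) → Finset (Fin n) → X) (cost : X → ℝ) :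
    OracleAlg n → Finset (Fin n)
  | output S => S
  | query I J next => run O cost (next (cost (O I J)))

/-- The number of oracle calls in that run. -/
def calls {X : Type u} {n : ℕ} (O : Finset (Fin n) → Finset (Fin n) → X) (cost : X → ℝ) :
    OracleAlg n → ℕ
  | output _ => 0
  | query I J next => calls O cost (next (cost (O I J))) + 1

end OracleAlg

/-- A randomized algorithm is a probability distribution over deterministic ones. -/
abbrev RandOracleAlg (n : ℕ) : Type := PMF (OracleAlg n)

end StrategicOracle

namespace StrategicOracle

/-! Maximizing `g_x` means minimizing the submodular function `v - P`, where `v` is the induced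
cost; an oracle call with no negative constraints evaluates `v`. Since `P` has total mass 1, a set
with `v S - v ∅ ≥ 1` is no better than `∅`, so `v` may be replaced by `u = min (v - v ∅) 1`, which
is again monotone and submodular.

Projected subgradient descent is run on the Lovász extension of `u - P` over the cube. At `y`, a
subgradient consists of the increments of `u` along the prefix chain sorting `y` in descending
order, minus `P`. Computing all increments would cost about `n` calls. Instead, a random level `θ`
in `(0, 1]` is drawn and binary search finds where the chain first reaches `θ`: the unit vector
there (zero if there is none) has the increments as its mean, up to grid rounding. It costs `O(log
n)` calls, and minus `P` it has squared norm at most 2 (`sum_sq_increment_sub_le`), so `O(n / ε²)`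
steps suffice (`sum_sqDist_step_le`, `sum_levelMin_iter_le`).

Some level set of `y` is at least as good as the Lovász extension at `y`. Testing the level sets of
every iterate would cost too much, so each trial stops at a uniformly random time and tests only the
last iterate. By Markov's inequality a trial fails with probability at most 1/2
(`two_mul_card_bad_le`), and independent repetition brings this down to `δ`. -/

/-! ### Prefix chains of a permutation -/

/-- The first `k` elements in the order given by `π`. -/
def prefixSet {n : ℕ} (π : Equiv.Perm (Fin n)) (k : ℕ) : Finset (Fin n) :=
  Finset.univ.filter fun i => (π.symm i : ℕ) < k

theorem mem_prefixSet {n : ℕ} {π : Equiv.Perm (Fin n)} {k : ℕ} {i : Fin n} :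
    i ∈ prefixSet π k ↔ (π.symm i : ℕ) < k := by
  simp [prefixSet]

theorem prefixSet_zero {n : ℕ} (π : Equiv.Perm (Fin n)) : prefixSet π 0 = ∅ := by
  ext i; simp [mem_prefixSet]

theorem prefixSet_card {n : ℕ} (π : Equiv.Perm (Fin n)) : prefixSet π n = Finset.univ := by
  ext i; simp [mem_prefixSet]

theorem prefixSet_mono {n : ℕ} (π : Equiv.Perm (Fin n)) : Monotone (prefixSet π) := by
  intro a b hab i hi
  rw [mem_prefixSet] at *
  omega

theorem apply_notMem_prefixSet {n : ℕ} (π : Equiv.Perm (Fin n)) (k : Fin n) :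
    π k ∉ prefixSet π k := by
  simp [mem_prefixSet]

theorem prefixSet_succ {n : ℕ} (π : Equiv.Perm (Fin n)) (k : Fin n) :
    prefixSet π (k + 1) = insert (π k) (prefixSet π k) := by
  ext i
  rw [Finset.mem_insert, mem_prefixSet, mem_prefixSet, ← Equiv.symm_apply_eq, Fin.ext_iff]
  omega

/-- The increment of `b` along the prefix chain of `π` at the element `i`. -/
def increment {n : ℕ} (π : Equiv.Perm (Fin n)) (b : ℕ → ℝ) (i : Fin n) : ℝ :=
  b (π.symm i + 1) - b (π.symm i)

theorem sum_mul_increment {n : ℕ} (π : Equiv.Perm (Fin n)) (b : ℕ → ℝ) (y : Fin n → ℝ) :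
    ∑ i, y i * increment π b i = ∑ k : Fin n, y (π k) * (b (k + 1) - b k) := by
  rw [← Equiv.sum_comp π]
  simp [increment]

theorem sum_increment {n : ℕ} (π : Equiv.Perm (Fin n)) (b : ℕ → ℝ) :
    ∑ i, increment π b i = b n - b 0 := by
  have := sum_mul_increment π b 1
  simp only [Pi.one_apply, one_mul] at this
  rw [this, Fin.sum_univ_eq_sum_range (fun k => b (k + 1) - b k), Finset.sum_range_sub]

theorem sum_prefixSet_succ {n : ℕ} (π : Equiv.Perm (Fin n)) (p : Fin n → ℝ) (k : Fin n) :
    ∑ i ∈ prefixSet π (k + 1), p i = p (π k) + ∑ i ∈ prefixSet π k, p i := by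
  rw [prefixSet_succ, Finset.sum_insert (apply_notMem_prefixSet π k)]

/-- Abel summation: a nonincreasing weighting in `[0, 1]` of the increments of a sequence that
starts at `0` and is bounded below by `m` has sum at least `m`. -/
theorem le_sum_mul_sub {n : ℕ} (a : Fin n → ℝ) (ha : Antitone a) (ha0 : ∀ k, 0 ≤ a k)
    (ha1 : ∀ k, a k ≤ 1) (G : ℕ → ℝ) (hG0 : G 0 = 0) (m : ℝ) (hm : ∀ k ≤ n, m ≤ G k) :
    m ≤ ∑ k : Fin n, a k * (G (k + 1) - G k) := by
  induction n generalizing m with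
  | zero => simpa [hG0] using hm 0 le_rfl
  | succ n ih =>
    -- Invariant for partial sums: passing from `j` to `j + 1` lowers the weight of the nonnegative
    -- number `G (j + 1) - m`.
    have key : ∀ j (hj : j < n + 1),
        a ⟨j, hj⟩ * (G (j + 1) - m) + m ≤
          ∑ k ∈ Finset.range (j + 1), (if h : k < n + 1 then a ⟨k, h⟩ else 0) * (G (k + 1) - G k) := by
      intro j
      induction j with
      | zero =>
        intro hj
        have h1 := hm 0 (Nat.zero_le _)
        rw [hG0] at h1
        simp only [zero_add, Finset.sum_range_one, hj, dif_pos, hG0, sub_zero]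
        nlinarith [ha1 ⟨0, hj⟩]
      | succ j ihj =>
        intro hj
        rw [Finset.sum_range_succ, dif_pos hj]
        have h1 := ihj (by omega)
        have h2 : a ⟨j + 1, hj⟩ ≤ a ⟨j, by omega⟩ := ha (by simp [Fin.le_def])
        have h3 := hm (j + 1) (by omega)
        nlinarith
    have h1 := key n (Nat.lt_succ_self n)
    rw [← Fin.sum_univ_eq_sum_range
      (fun k => (if h : k < n + 1 then a ⟨k, h⟩ else 0) * (G (k + 1) - G k))] at h1
    simp only [Fin.is_lt, dif_pos, Fin.eta] at h1
    have h2 := mul_nonneg (ha0 ⟨n, Nat.lt_succ_self n⟩) (sub_nonneg.2 (hm (n + 1) le_rfl))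
    linarith

/-! ### Truncated submodular functions and their polymatroids -/

/-- Normalized monotone submodular set functions bounded by one. -/
structure IsUnitSubmodular {n : ℕ} (u : Finset (Fin n) → ℝ) : Prop where
  empty : u ∅ = 0
  mono : Monotone u
  le_one : ∀ S, u S ≤ 1
  submodular : ∀ S S' : Finset (Fin n), S ⊆ S' → ∀ i, i ∉ S' →
    u (insert i S') - u S' ≤ u (insert i S) - u S

theorem IsUnitSubmodular.nonneg {n : ℕ} {u : Finset (Fin n) → ℝ} (hu : IsUnitSubmodular u)
    (S : Finset (Fin n)) : 0 ≤ u S :=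
  hu.empty ▸ hu.mono (Finset.empty_subset S)

/-- Truncating a monotone submodular function at one unit above its value at `∅`. -/
theorem isUnitSubmodular_truncate {n : ℕ} {v : Finset (Fin n) → ℝ} (hmono : Monotone v)
    (hsub : ∀ S S' : Finset (Fin n), S ⊆ S' → ∀ i, i ∉ S' →
      v (insert i S') - v S' ≤ v (insert i S) - v S) :
    IsUnitSubmodular fun S => min (v S - v ∅) 1 where
  empty := by simp
  mono S S' h := min_le_min_right _ (sub_le_sub_right (hmono h) _)
  le_one S := min_le_right _ _
  submodular S S' h i hi := by
    have h1 := hsub S S' h i hi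
    have h2 := hmono h
    have h3 := hmono (Finset.insert_subset_insert i h)
    have h4 := hmono (Finset.subset_insert i S)
    have h5 := hmono (Finset.subset_insert i S')
    -- If `S'` is capped, the left side is 0 and the right side is nonnegative. Otherwise `S` is
    -- uncapped too, and by monotonicity the cap reaches `insert i S'` no later than `insert i S`.
    simp only [min_def]
    split_ifs <;> linarith

/-- The increments along a chain lie in the polymatroid of `u`. -/
theorem IsUnitSubmodular.sum_increment_le {n : ℕ} {u : Finset (Fin n) → ℝ}
    (hu : IsUnitSubmodular u) (π : Equiv.Perm (Fin n)) (S : Finset (Fin n)) :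
    ∑ i ∈ S, increment π (fun k => u (prefixSet π k)) i ≤ u S := by
  -- Induction along the chain: an element of `S` gains no more on top of the full prefix than on
  -- top of its intersection with `S`.
  have key : ∀ k ≤ n, ∑ i ∈ S ∩ prefixSet π k, increment π (fun k => u (prefixSet π k)) i ≤
      u (S ∩ prefixSet π k) := by
    intro k
    induction k with
    | zero => intro _; simp [prefixSet_zero, hu.empty]
    | succ k ih =>
      intro hk
      have ih := ih (by omega)
      have hs := prefixSet_succ π ⟨k, hk⟩
      have hn := apply_notMem_prefixSet π ⟨k, hk⟩
      simp only at hs hn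
      by_cases h : π ⟨k, hk⟩ ∈ S
      · rw [hs, Finset.inter_insert_of_mem h, Finset.sum_insert (by simp [hn])]
        have h1 := hu.submodular (S ∩ prefixSet π k) _ Finset.inter_subset_right _ hn
        have h2 : increment π (fun k => u (prefixSet π k)) (π ⟨k, hk⟩) =
            u (insert (π ⟨k, hk⟩) (prefixSet π k)) - u (prefixSet π k) := by
          simp [increment, hs]
        linarith
      · rwa [hs, Finset.inter_insert_of_notMem h]
  simpa [prefixSet_card] using key n le_rfl

/-! ### Sampling the increments by a random threshold -/

/-- The number of grid points `(j + 1) / M` that are at most `w`. -/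
theorem sum_grid_le {M : ℕ} (hM : 0 < M) {w : ℝ} (h0 : 0 ≤ w) (h1 : w ≤ 1) :
    (∑ j : Fin M, if ((j : ℝ) + 1) / M ≤ w then (1 : ℝ) else 0) ≤ M * w ∧
      M * w - 1 ≤ ∑ j : Fin M, if ((j : ℝ) + 1) / M ≤ w then (1 : ℝ) else 0 := by
  have hM' : (0 : ℝ) < M := by exact_mod_cast hM
  have hw : 0 ≤ M * w := by positivity
  have hiff : ∀ j : Fin M, ((j : ℝ) + 1) / M ≤ w ↔ (j : ℕ) < ⌊M * w⌋₊ := by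
    intro j
    rw [← Nat.succ_le_iff, Nat.le_floor_iff hw, div_le_iff₀ hM', mul_comm]
    push_cast
    rfl
  have hle : ⌊M * w⌋₊ ≤ M := by
    apply Nat.floor_le_of_le
    nlinarith
  have hsum : (∑ j : Fin M, if ((j : ℝ) + 1) / M ≤ w then (1 : ℝ) else 0) = ⌊M * w⌋₊ := by
    simp only [hiff, Finset.sum_boole]
    rw [Fin.card_filter_val_lt, min_eq_right hle]
  rw [hsum]
  exact ⟨Nat.floor_le hw, by linarith [Nat.lt_floor_add_one (M * w)]⟩

/-- The indicator of `u (prefixSet π k)` reaching the level `θ`. -/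
noncomputable def reach {n : ℕ} (u : Finset (Fin n) → ℝ) (π : Equiv.Perm (Fin n)) (θ : ℝ)
    (k : ℕ) : ℝ :=
  if θ ≤ u (prefixSet π k) then 1 else 0

/-! ### One step of projected stochastic subgradient descent -/

/-- Clipping to the unit interval. -/
noncomputable def clip (t : ℝ) : ℝ := max 0 (min 1 t)

theorem clip_nonneg (t : ℝ) : 0 ≤ clip t := le_max_left _ _

theorem clip_le_one (t : ℝ) : clip t ≤ 1 := max_le zero_le_one (min_le_left _ _)

/-- Projecting onto an interval brings a point no farther from any point of that interval. -/
theorem sq_clip_sub_le {t s : ℝ} (h0 : 0 ≤ s) (h1 : s ≤ 1) : (clip t - s) ^ 2 ≤ (t - s) ^ 2 := by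
  unfold clip
  rcases le_total 1 t with h | h
  · rw [min_eq_left h, max_eq_right zero_le_one]; nlinarith
  · rw [min_eq_right h]
    rcases le_total 0 t with h' | h'
    · rw [max_eq_right h']
    · rw [max_eq_left h']; nlinarith

/-- A permutation that lists the coordinates of `y` in nonincreasing order. -/
noncomputable def descOrder {n : ℕ} (y : Fin n → ℝ) : Equiv.Perm (Fin n) :=
  Tuple.sort fun i => -y i

theorem antitone_comp_descOrder {n : ℕ} (y : Fin n → ℝ) : Antitone (y ∘ descOrder y) := by
  intro a b hab
  have := Tuple.monotone_sort (fun i => -y i) hab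
  simpa [descOrder] using this

/-- A projected step along the direction `e - P`. -/
noncomputable def move {n : ℕ} (P : Fin n → ℝ) (η : ℝ) (y e : Fin n → ℝ) : Fin n → ℝ :=
  fun i => clip (y i - η * (e i - P i))

/-- The step of stochastic subgradient descent for the threshold `θ`. -/
noncomputable def step {n : ℕ} (u : Finset (Fin n) → ℝ) (P : Fin n → ℝ) (η θ : ℝ)
    (y : Fin n → ℝ) : Fin n → ℝ :=
  move P η y (increment (descOrder y) (reach u (descOrder y) θ))

/-- The squared distance to the indicator vector of `S`. -/
noncomputable def sqDist {n : ℕ} (y : Fin n → ℝ) (S : Finset (Fin n)) : ℝ :=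
  ∑ i, (y i - if i ∈ S then 1 else 0) ^ 2

theorem sqDist_nonneg {n : ℕ} (y : Fin n → ℝ) (S : Finset (Fin n)) : 0 ≤ sqDist y S :=
  Finset.sum_nonneg fun _ _ => sq_nonneg _

theorem sqDist_zero_le {n : ℕ} (S : Finset (Fin n)) : sqDist 0 S ≤ n := by
  calc sqDist 0 S ≤ ∑ _i : Fin n, (1 : ℝ) := Finset.sum_le_sum fun i _ => by
        split_ifs <;> simp
    _ = n := by simp

/-- The standard descent inequality: drop the projection and expand the square. -/
theorem sqDist_move_le {n : ℕ} (P : Fin n → ℝ) (η : ℝ) (y e : Fin n → ℝ) (S : Finset (Fin n)) :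
    sqDist (move P η y e) S ≤ sqDist y S
      - 2 * η * (∑ i, y i * (e i - P i) - ∑ i ∈ S, (e i - P i))
      + η ^ 2 * ∑ i, (e i - P i) ^ 2 := by
  have h : ∑ i ∈ S, (e i - P i) = ∑ i, (if i ∈ S then 1 else 0) * (e i - P i) := by
    simp
  rw [h, ← Finset.sum_sub_distrib, Finset.mul_sum, Finset.mul_sum, sqDist, sqDist,
    ← Finset.sum_sub_distrib, ← Finset.sum_add_distrib]
  refine Finset.sum_le_sum fun i _ => ?_
  have h0 : (0 : ℝ) ≤ if i ∈ S then 1 else 0 := by split_ifs <;> norm_num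
  have h1 : (if i ∈ S then 1 else 0 : ℝ) ≤ 1 := by split_ifs <;> norm_num
  refine (sq_clip_sub_le h0 h1).trans (le_of_eq ?_)
  ring

theorem increment_reach_mem {n : ℕ} {u : Finset (Fin n) → ℝ} (hu : IsUnitSubmodular u)
    (π : Equiv.Perm (Fin n)) (θ : ℝ) (i : Fin n) :
    0 ≤ increment π (reach u π θ) i ∧ increment π (reach u π θ) i ≤ 1 := by
  have h := hu.mono (prefixSet_mono π (Nat.le_succ (π.symm i : ℕ)))
  unfold increment reach
  simp only [Nat.succ_eq_add_one] at h
  split_ifs <;> first | (exfalso; linarith) | norm_num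

/-- Coordinatewise `(e - P)² ≤ e + P` for values in `[0, 1]`; the increments telescope to at most 1
and `P` sums to 1. The bound does not depend on `n`. -/
theorem sum_sq_increment_sub_le {n : ℕ} {u : Finset (Fin n) → ℝ} (hu : IsUnitSubmodular u)
    {P : Fin n → ℝ} (hP : P ∈ stdSimplex ℝ (Fin n)) (π : Equiv.Perm (Fin n)) (θ : ℝ) :
    ∑ i, (increment π (reach u π θ) i - P i) ^ 2 ≤ 2 := by
  have h : ∑ i, (increment π (reach u π θ) i - P i) ^ 2 ≤
      ∑ i, (increment π (reach u π θ) i + P i) := by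
    refine Finset.sum_le_sum fun i _ => ?_
    obtain ⟨h0, h1⟩ := increment_reach_mem hu π θ i
    have h2 := hP.1 i
    have h3 : P i ≤ 1 := hP.2 ▸ Finset.single_le_sum (fun j _ => hP.1 j) (Finset.mem_univ i)
    nlinarith
  refine h.trans ?_
  rw [Finset.sum_add_distrib, sum_increment, hP.2]
  unfold reach
  split_ifs <;> norm_num

/-- The grid of thresholds. -/
noncomputable def grid {M : ℕ} (j : Fin M) : ℝ := ((j : ℝ) + 1) / M

/-- One step decreases the expected squared distance to a target set `S` in proportion to the
difference between the best level set of `y` and `S`. -/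
theorem sum_sqDist_step_le {n : ℕ} {u : Finset (Fin n) → ℝ} (hu : IsUnitSubmodular u)
    {P : Fin n → ℝ} (hP : P ∈ stdSimplex ℝ (Fin n)) {η : ℝ} (hη : 0 ≤ η) {y : Fin n → ℝ}
    (hy0 : ∀ i, 0 ≤ y i) (hy1 : ∀ i, y i ≤ 1) (S : Finset (Fin n)) {M : ℕ} (hM : 0 < M) {m : ℝ}
    (hm : ∀ k ≤ n, m ≤ u (prefixSet (descOrder y) k) - ∑ i ∈ prefixSet (descOrder y) k, P i) :
    ∑ j : Fin M, sqDist (step u P η (grid j) y) S ≤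
      M * (sqDist y S - 2 * η * (m - (u S - ∑ i ∈ S, P i) - (n + 1) / M) + 2 * η ^ 2) := by
  set π := descOrder y with hπ
  have hM' : (0 : ℝ) < M := by exact_mod_cast hM
  -- Summed over the grid, the indicators give `M * u` rounded down, so `b` is within 1 of `M * u`.
  set b : ℕ → ℝ := fun k => ∑ j : Fin M, reach u π (grid j) k with hb
  have hb_le : ∀ k, b k ≤ M * u (prefixSet π k) := fun k =>
    (sum_grid_le hM (hu.nonneg _) (hu.le_one _)).1
  have hb_ge : ∀ k, M * u (prefixSet π k) - 1 ≤ b k := fun k =>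
    (sum_grid_le hM (hu.nonneg _) (hu.le_one _)).2
  have hinc : ∀ i, ∑ j : Fin M, increment π (reach u π (grid j)) i = increment π b i := by
    intro i
    simp [increment, hb]
  -- Abel summation: the Lovász extension at `y` is at least the best level-set value. Rounding
  -- costs 1 here.
  have hy : M * m - 1 ≤ ∑ i, y i * (increment π b i - M * P i) := by
    have hPinc : ∀ i, increment π (fun k => ∑ i ∈ prefixSet π k, P i) i = P i := by
      intro i
      have := sum_prefixSet_succ π P (π.symm i)
      simp only [Equiv.apply_symm_apply] at this
      simp [increment, this]
    have e1 : ∀ i, increment π b i - M * P i =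
        increment π (fun k => b k - M * ∑ i ∈ prefixSet π k, P i) i := by
      intro i
      rw [← hPinc i]
      simp only [increment]
      ring
    simp only [e1]
    rw [sum_mul_increment]
    refine le_sum_mul_sub (y ∘ π) (antitone_comp_descOrder y) (fun k => hy0 _) (fun k => hy1 _)
      (fun k => b k - M * ∑ i ∈ prefixSet π k, P i) ?_ _ ?_
    · have h1 := hb_le 0
      have h2 : 0 ≤ b 0 := Finset.sum_nonneg fun j _ => by unfold reach; split_ifs <;> norm_num
      rw [prefixSet_zero, hu.empty] at h1
      simp only [prefixSet_zero, Finset.sum_empty]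
      linarith
    · intro k hk
      have h1 := mul_le_mul_of_nonneg_left (hm k hk) hM'.le
      have h2 := hb_ge k
      linarith
  -- The polymatroid inequality, with a rounding error of at most 1 per element of `S`; hence `(n +
  -- 1) / M` in total.
  have hS : ∑ i ∈ S, (increment π b i - M * P i) ≤ M * (u S - ∑ i ∈ S, P i) + n := by
    have h1 : ∑ i ∈ S, increment π b i ≤
        ∑ i ∈ S, (M * increment π (fun k => u (prefixSet π k)) i + 1) := by
      refine Finset.sum_le_sum fun i _ => ?_
      have h1 := hb_le (π.symm i + 1)
      have h2 := hb_ge (π.symm i)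
      simp only [increment]
      linarith
    rw [Finset.sum_add_distrib, ← Finset.mul_sum] at h1
    have h2 := mul_le_mul_of_nonneg_left (hu.sum_increment_le π S) hM'.le
    have h3 : ∑ i ∈ S, (1 : ℝ) ≤ n := by
      have := S.card_le_univ
      simp only [Fintype.card_fin] at this
      simpa using this
    rw [Finset.sum_sub_distrib, ← Finset.mul_sum]
    linarith
  have hstep : ∀ j : Fin M, sqDist (step u P η (grid j) y) S ≤ sqDist y S
      - 2 * η * (∑ i, y i * (increment π (reach u π (grid j)) i - P i)
        - ∑ i ∈ S, (increment π (reach u π (grid j)) i - P i)) + η ^ 2 * 2 := by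
    intro j
    refine (sqDist_move_le P η y _ S).trans ?_
    have := mul_le_mul_of_nonneg_left (sum_sq_increment_sub_le hu hP π (grid j)) (sq_nonneg η)
    linarith
  refine (Finset.sum_le_sum fun j _ => hstep j).trans ?_
  rw [Finset.sum_add_distrib, Finset.sum_sub_distrib, ← Finset.mul_sum, Finset.sum_sub_distrib,
    Finset.sum_comm, Finset.sum_comm (t := S)]
  simp only [← Finset.mul_sum, Finset.sum_sub_distrib (f := fun j : Fin M => increment _ _ _), hinc]
  simp only [Finset.sum_const, Finset.card_univ, Fintype.card_fin, nsmul_eq_mul]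
  have h4 : (M : ℝ) * ((n + 1) / M) = n + 1 := by field_simp
  have h5 : M * (m - (u S - ∑ i ∈ S, P i) - (n + 1) / M) ≤
      ∑ i, y i * (increment π b i - M * P i) - ∑ i ∈ S, (increment π b i - M * P i) := by
    rw [mul_sub, h4]; linarith
  have h6 := mul_le_mul_of_nonneg_left h5 (by positivity : 0 ≤ 2 * η)
  nlinarith

/-! ### The descent -/

/-- The iterate after the steps with the given thresholds. -/
noncomputable def iter {n : ℕ} (u : Finset (Fin n) → ℝ) (P : Fin n → ℝ) (η : ℝ) :
    List ℝ → (Fin n → ℝ) → Fin n → ℝ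
  | [], y => y
  | θ :: l, y => iter u P η l (step u P η θ y)

/-- The least value of `u - P` over the level sets of `y`. -/
noncomputable def levelMin {n : ℕ} (u : Finset (Fin n) → ℝ) (P : Fin n → ℝ) (y : Fin n → ℝ) : ℝ :=
  (Finset.range (n + 1)).inf' Finset.nonempty_range_add_one fun k =>
    u (prefixSet (descOrder y) k) - ∑ i ∈ prefixSet (descOrder y) k, P i

/-- The expected sum of the values of the iterates. -/
theorem sum_levelMin_iter_le {n : ℕ} {u : Finset (Fin n) → ℝ} (hu : IsUnitSubmodular u)
    {P : Fin n → ℝ} (hP : P ∈ stdSimplex ℝ (Fin n)) {η : ℝ} (hη : 0 < η) (S : Finset (Fin n))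
    {M : ℕ} (hM : 0 < M) (T : ℕ) {y : Fin n → ℝ} (hy0 : ∀ i, 0 ≤ y i) (hy1 : ∀ i, y i ≤ 1) :
    ∑ ω : Fin T → Fin M, ∑ t : Fin T,
        levelMin u P (iter u P η ((List.ofFn fun s => grid (ω s)).take t) y) ≤
      (M : ℝ) ^ T *
        (T * (u S - ∑ i ∈ S, P i + (n + 1) / M + η) + sqDist y S / (2 * η)) := by
  have hM' : (0 : ℝ) < M := by exact_mod_cast hM
  induction T generalizing y with
  | zero =>
    have := sqDist_nonneg y S
    simp only [Finset.univ_eq_empty, Finset.sum_empty, Finset.sum_const_zero]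
    simp only [pow_zero, Nat.cast_zero, zero_mul, zero_add, one_mul]
    positivity
  | succ T ih =>
    -- Condition on the first threshold; the potential `sqDist / (2 * η)` then pays for the first
    -- iterate and telescopes.
    rw [← (Fin.consEquiv fun _ : Fin (T + 1) => Fin M).sum_comp, Fintype.sum_prod_type]
    simp only [Fin.consEquiv_apply, Fin.sum_univ_succ, List.ofFn_succ, Fin.cons_zero,
      Fin.cons_succ, Fin.val_zero, Fin.val_succ, List.take_zero, List.take_succ_cons, iter]
    have h1 : ∀ j : Fin M, ∑ ω : Fin T → Fin M, (levelMin u P y + ∑ t : Fin T, levelMin u P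
        (iter u P η ((List.ofFn fun s => grid (ω s)).take t) (step u P η (grid j) y))) ≤
        (M : ℝ) ^ T * (levelMin u P y + (T * (u S - ∑ i ∈ S, P i + (n + 1) / M + η)
          + sqDist (step u P η (grid j) y) S / (2 * η))) := by
      intro j
      rw [Finset.sum_add_distrib, mul_add]
      refine add_le_add (le_of_eq ?_)
        (ih (fun i => clip_nonneg _) (fun i => clip_le_one _))
      simp
    refine (Finset.sum_le_sum fun j _ => h1 j).trans ?_
    rw [← Finset.mul_sum, pow_succ, mul_assoc]
    refine mul_le_mul_of_nonneg_left ?_ (by positivity)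
    have h2 := sum_sqDist_step_le hu hP hη.le hy0 hy1 S hM (m := levelMin u P y) fun k hk =>
      Finset.inf'_le _ (Finset.mem_range.2 (by omega))
    simp only [Finset.sum_add_distrib, ← Finset.sum_div, Finset.sum_const, Finset.card_univ,
      Fintype.card_fin, nsmul_eq_mul]
    have h3 := div_le_div_of_nonneg_right h2 (by positivity : 0 ≤ 2 * η)
    have h4 : M * (sqDist y S - 2 * η * (levelMin u P y - (u S - ∑ i ∈ S, P i) - (n + 1) / M)
        + 2 * η ^ 2) / (2 * η) = M * (sqDist y S / (2 * η)
          - (levelMin u P y - (u S - ∑ i ∈ S, P i) - (n + 1) / M) + η) := by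
      field_simp
    rw [h4] at h3
    push_cast
    linarith

/-- A single trial, with suitable parameters, fails for at most half of its random bits. -/
theorem two_mul_card_bad_le {n : ℕ} {u : Finset (Fin n) → ℝ} (hu : IsUnitSubmodular u)
    {P : Fin n → ℝ} (hP : P ∈ stdSimplex ℝ (Fin n)) {ε : ℝ} (hε : 0 < ε) (hn : 0 < n)
    {M : ℕ} (hM : 8 * n / ε ≤ M) {T : ℕ} (hT : 32 * n / ε ^ 2 ≤ T) :
    2 * (Finset.univ.filter fun s : (Fin T → Fin M) × Fin T => ∃ S : Finset (Fin n),
        u S - ∑ i ∈ S, P i + ε < levelMin u P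
          (iter u P (ε / 8) ((List.ofFn fun t => grid (s.1 t)).take s.2) 0)).card ≤
      Fintype.card ((Fin T → Fin M) × Fin T) := by
  have hn' : (1 : ℝ) ≤ n := by exact_mod_cast hn
  have hM' : (0 : ℝ) < M := lt_of_lt_of_le (by positivity) hM
  have hM0 : 0 < M := by exact_mod_cast hM'
  have hT' : (0 : ℝ) < T := lt_of_lt_of_le (by positivity) hT
  obtain ⟨S₀, -, hS₀⟩ := Finset.exists_min_image Finset.univ
    (fun S : Finset (Fin n) => u S - ∑ i ∈ S, P i) Finset.univ_nonempty
  set f : Finset (Fin n) → ℝ := fun S => u S - ∑ i ∈ S, P i with hf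
  set Z : (Fin T → Fin M) × Fin T → ℝ := fun s => levelMin u P
    (iter u P (ε / 8) ((List.ofFn fun t => grid (s.1 t)).take s.2) 0) with hZ
  have hZ0 : ∀ s, f S₀ ≤ Z s := fun s =>
    Finset.le_inf' _ _ fun k _ => hS₀ _ (Finset.mem_univ _)
  have hsum := sum_levelMin_iter_le hu hP (by positivity : 0 < ε / 8) S₀ hM0 T (y := 0)
    (fun _ => le_rfl) (fun _ => zero_le_one)
  rw [← Fintype.sum_prod_type (f := Z)] at hsum
  have hN : (Fintype.card ((Fin T → Fin M) × Fin T) : ℝ) = (M : ℝ) ^ T * T := by simp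
  -- Error budget: grid `ε / 4`, step size `ε / 8`, initial distance `ε / 8`. The mean excess is at
  -- most `ε / 2`, and Markov's inequality at level `ε` gives one half.
  have hMb : (n + 1) / (M : ℝ) ≤ ε / 4 := by
    rw [div_le_iff₀ hM']
    rw [div_le_iff₀ hε] at hM
    linarith
  have hTb : sqDist (0 : Fin n → ℝ) S₀ / (2 * (ε / 8)) ≤ T * (ε / 8) := by
    rw [div_le_iff₀ (by positivity)]
    rw [div_le_iff₀ (by positivity)] at hT
    have := sqDist_zero_le S₀
    nlinarith
  set B := Finset.univ.filter fun s : (Fin T → Fin M) × Fin T => ∃ S, f S + ε < Z s with hB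
  have hmarkov : (B.card : ℝ) * ε ≤ ∑ s, (Z s - f S₀) := by
    rw [← nsmul_eq_mul]
    refine (Finset.card_nsmul_le_sum B _ _ fun s hs => ?_).trans
      (Finset.sum_le_sum_of_subset_of_nonneg (Finset.subset_univ B) fun s _ _ =>
        sub_nonneg.2 (hZ0 s))
    obtain ⟨S, hS⟩ := (Finset.mem_filter.1 hs).2
    have := hS₀ S (Finset.mem_univ _)
    linarith
  rw [Finset.sum_sub_distrib, Finset.sum_const, Finset.card_univ, nsmul_eq_mul, hN] at hmarkov
  have h1 : (M : ℝ) ^ T * (T * (u S₀ - ∑ i ∈ S₀, P i + (n + 1) / M + ε / 8)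
      + sqDist 0 S₀ / (2 * (ε / 8))) ≤ (M : ℝ) ^ T * (T * (f S₀ + ε / 2)) := by
    refine mul_le_mul_of_nonneg_left ?_ (by positivity)
    have : T * ((n + 1) / (M : ℝ)) ≤ T * (ε / 4) := mul_le_mul_of_nonneg_left hMb hT'.le
    simp only [hf]
    linarith
  have h2 : (B.card : ℝ) * ε ≤ (M : ℝ) ^ T * T / 2 * ε := by linarith
  have h3 := le_of_mul_le_mul_right h2 hε
  have h4 : ((2 * B.card : ℕ) : ℝ) ≤ (Fintype.card ((Fin T → Fin M) × Fin T) : ℕ) := by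
    rw [hN]; push_cast; linarith
  exact_mod_cast h4


/-! ### The algorithm -/

/-- Binary search along the prefix chain of `π` for the first set whose induced cost exceeds `v₀`
by at least `θ`. -/
noncomputable def bisect {n : ℕ} (v₀ θ : ℝ) (π : Equiv.Perm (Fin n)) (cont : ℕ → OracleAlg n) :
    ℕ → ℕ → ℕ → OracleAlg n
  | 0, _, hi => cont hi
  | f + 1, lo, hi => .query (prefixSet π ((lo + hi) / 2)) ∅ fun a =>
      if θ ≤ min (a - v₀) 1 then bisect v₀ θ π cont f lo ((lo + hi) / 2)
      else bisect v₀ θ π cont f ((lo + hi) / 2) hi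

/-- Stochastic subgradient descent with the given thresholds. -/
noncomputable def descend {n : ℕ} (v₀ : ℝ) (P : Fin n → ℝ) (η : ℝ)
    (cont : (Fin n → ℝ) → OracleAlg n) : List ℝ → (Fin n → ℝ) → OracleAlg n
  | [], y => cont y
  | θ :: l, y => bisect v₀ θ (descOrder y)
      (fun r => descend v₀ P η cont l
        (move P η y (increment (descOrder y) fun k => if r ≤ k then 1 else 0)))
      (Nat.log 2 n + 1) 0 (2 ^ (Nat.log 2 n + 1))

/-- Among the sets of a list and the current set `S` of value `b`, find one of least value. -/
noncomputable def select {n : ℕ} (P : Fin n → ℝ) (cont : Finset (Fin n) → ℝ → OracleAlg n) :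
    List (Finset (Fin n)) → Finset (Fin n) → ℝ → OracleAlg n
  | [], S, b => cont S b
  | A :: l, S, b => .query A ∅ fun a =>
      if a - ∑ i ∈ A, P i < b then select P cont l A (a - ∑ i ∈ A, P i) else select P cont l S b

/-- The level sets of `y`. -/
noncomputable def levels {n : ℕ} (y : Fin n → ℝ) : List (Finset (Fin n)) :=
  (List.range (n + 1)).map (prefixSet (descOrder y))

/-- Run a descent for every list of thresholds, and output the best level set found. -/
noncomputable def trials {n : ℕ} (v₀ : ℝ) (P : Fin n → ℝ) (η : ℝ) :
    List (List ℝ) → Finset (Fin n) → ℝ → OracleAlg n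
  | [], S, _ => .output S
  | s :: l, S, b =>
      descend v₀ P η (fun y => select P (trials v₀ P η l) (levels y) S b) s 0

/-- The whole algorithm for given thresholds. -/
noncomputable def minimizer {n : ℕ} (P : Fin n → ℝ) (η : ℝ) (s : List (List ℝ)) : OracleAlg n :=
  .query ∅ ∅ fun v₀ => trials v₀ P η s ∅ v₀

section Spec

variable {X : Type u} {n : ℕ} {O : Finset (Fin n) → Finset (Fin n) → X} {cost : X → ℝ}
  {v : Finset (Fin n) → ℝ}

/-- The crossing index stays in `(lo, hi]`, an interval of length at most `2 ^ f`. The claim is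
limited to `k ≤ n` because a level that is never reached yields some `r > n`. -/
theorem bisect_spec (hv : ∀ S, cost (O S ∅) = v S) (hmono : Monotone v) (v₀ θ : ℝ)
    (π : Equiv.Perm (Fin n)) (cont : ℕ → OracleAlg n) (f lo hi : ℕ) (hle : hi ≤ lo + 2 ^ f)
    (hlo : ∀ k ≤ n, θ ≤ min (v (prefixSet π k) - v₀) 1 → lo < k)
    (hhi : ∀ k ≤ n, hi ≤ k → θ ≤ min (v (prefixSet π k) - v₀) 1) :
    ∃ r, (∀ k ≤ n, θ ≤ min (v (prefixSet π k) - v₀) 1 ↔ r ≤ k) ∧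
      (bisect v₀ θ π cont f lo hi).run O cost = (cont r).run O cost ∧
      (bisect v₀ θ π cont f lo hi).calls O cost = f + (cont r).calls O cost := by
  induction f generalizing lo hi with
  | zero =>
    refine ⟨hi, fun k hk => ⟨fun h => ?_, hhi k hk⟩, rfl, by simp [bisect]⟩
    have := hlo k hk h
    simp only [pow_zero] at hle
    omega
  | succ f ih =>
    have hm : ∀ a b, a ≤ b → min (v (prefixSet π a) - v₀) 1 ≤ min (v (prefixSet π b) - v₀) 1 :=
      fun a b h => min_le_min_right _ (sub_le_sub_right (hmono (prefixSet_mono π h)) _)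
    rw [pow_succ] at hle
    simp only [bisect, OracleAlg.run, OracleAlg.calls, hv]
    split_ifs with h
    · obtain ⟨r, h1, h2, h3⟩ := ih lo ((lo + hi) / 2) (by omega) hlo
        fun k _ hk => h.trans (hm _ _ hk)
      exact ⟨r, h1, h2, by rw [h3]; omega⟩
    · obtain ⟨r, h1, h2, h3⟩ := ih ((lo + hi) / 2) hi (by omega)
        (fun k _ hk => by
          by_contra hc
          exact h (hk.trans (hm _ _ (not_lt.1 hc)))) hhi
      exact ⟨r, h1, h2, by rw [h3]; omega⟩

/-- The crossing index determines `reach` at all `k ≤ n`, hence the whole step. Positivity of `θ`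
keeps the empty prefix below the level, and the initial upper end exceeds `n`. -/
theorem descend_spec (hv : ∀ S, cost (O S ∅) = v S) (hmono : Monotone v) (P : Fin n → ℝ)
    (η : ℝ) (cont : (Fin n → ℝ) → OracleAlg n) (l : List ℝ) (hl : ∀ θ ∈ l, 0 < θ)
    (y : Fin n → ℝ) :
    (descend (v ∅) P η cont l y).run O cost =
        (cont (iter (fun S => min (v S - v ∅) 1) P η l y)).run O cost ∧
      (descend (v ∅) P η cont l y).calls O cost = l.length * (Nat.log 2 n + 1) +
        (cont (iter (fun S => min (v S - v ∅) 1) P η l y)).calls O cost := by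
  induction l generalizing y with
  | nil => simp [descend, iter]
  | cons θ l ih =>
    have hθ := hl θ List.mem_cons_self
    obtain ⟨r, h1, h2, h3⟩ := bisect_spec hv hmono (v ∅) θ (descOrder y)
      (fun r => descend (v ∅) P η cont l
        (move P η y (increment (descOrder y) fun k => if r ≤ k then 1 else 0)))
      (Nat.log 2 n + 1) 0 (2 ^ (Nat.log 2 n + 1)) (by omega)
      (fun k _ h => by
        refine Nat.pos_of_ne_zero fun hk => ?_
        rw [hk, prefixSet_zero] at h
        have := h.trans (min_le_left _ _)
        linarith)
      (fun k hk h => absurd (Nat.lt_pow_succ_log_self (b := 2) (by norm_num) n) (by omega))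
    have h4 : move P η y (increment (descOrder y) fun k => if r ≤ k then 1 else 0) =
        step (fun S => min (v S - v ∅) 1) P η θ y := by
      unfold step
      congr 1
      funext i
      have hi := ((descOrder y).symm i).isLt
      simp only [increment, reach]
      rw [if_congr (h1 _ hi) rfl rfl, if_congr (h1 _ hi.le) rfl rfl]
    obtain ⟨h5, h6⟩ := ih (fun θ h => hl θ (List.mem_cons_of_mem _ h))
      (step (fun S => min (v S - v ∅) 1) P η θ y)
    simp only [descend, iter, List.length_cons]
    rw [h2, h3, h4, h5, h6]
    exact ⟨rfl, by ring⟩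

theorem select_spec (hv : ∀ S, cost (O S ∅) = v S) (P : Fin n → ℝ)
    (cont : Finset (Fin n) → ℝ → OracleAlg n) (l : List (Finset (Fin n))) (S : Finset (Fin n)) :
    ∃ S', (∀ A ∈ S :: l, v S' - ∑ i ∈ S', P i ≤ v A - ∑ i ∈ A, P i) ∧
      (select P cont l S (v S - ∑ i ∈ S, P i)).run O cost =
        (cont S' (v S' - ∑ i ∈ S', P i)).run O cost ∧
      (select P cont l S (v S - ∑ i ∈ S, P i)).calls O cost =
        l.length + (cont S' (v S' - ∑ i ∈ S', P i)).calls O cost := by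
  induction l generalizing S with
  | nil => exact ⟨S, by simp, rfl, by simp [select]⟩
  | cons A l ih =>
    simp only [select, OracleAlg.run, OracleAlg.calls, hv, List.length_cons]
    split_ifs with h
    · obtain ⟨S', h1, h2, h3⟩ := ih A
      refine ⟨S', ?_, h2, by rw [h3]; omega⟩
      simp only [List.forall_mem_cons] at h1 ⊢
      exact ⟨h1.1.trans h.le, h1⟩
    · obtain ⟨S', h1, h2, h3⟩ := ih S
      refine ⟨S', ?_, h2, by rw [h3]; omega⟩
      simp only [List.forall_mem_cons] at h1 ⊢
      exact ⟨h1.1, h1.1.trans (not_lt.1 h), h1.2⟩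

theorem trials_spec (hv : ∀ S, cost (O S ∅) = v S) (hmono : Monotone v) (P : Fin n → ℝ)
    (η : ℝ) (T : ℕ) (L : List (List ℝ)) (hL : ∀ l ∈ L, (∀ θ ∈ l, 0 < θ) ∧ l.length ≤ T)
    (S : Finset (Fin n)) :
    ∃ S', (trials (v ∅) P η L S (v S - ∑ i ∈ S, P i)).run O cost = S' ∧
      v S' - ∑ i ∈ S', P i ≤ v S - ∑ i ∈ S, P i ∧
      (∀ l ∈ L, ∀ A ∈ levels (iter (fun S => min (v S - v ∅) 1) P η l 0),
        v S' - ∑ i ∈ S', P i ≤ v A - ∑ i ∈ A, P i) ∧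
      (trials (v ∅) P η L S (v S - ∑ i ∈ S, P i)).calls O cost ≤
        L.length * (T * (Nat.log 2 n + 1) + (n + 1)) := by
  induction L generalizing S with
  | nil => exact ⟨S, rfl, le_rfl, by simp, by simp [trials, OracleAlg.calls]⟩
  | cons l L ih =>
    obtain ⟨hl, hlT⟩ := hL l List.mem_cons_self
    obtain ⟨h1, h2⟩ := descend_spec hv hmono P η (fun y => select P (trials (v ∅) P η L)
      (levels y) S (v S - ∑ i ∈ S, P i)) l hl 0
    obtain ⟨A, h3, h4, h5⟩ := select_spec hv P (trials (v ∅) P η L)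
      (levels (iter (fun S => min (v S - v ∅) 1) P η l 0)) S
    obtain ⟨S', h6, h7, h8, h9⟩ := ih (fun l h => hL l (List.mem_cons_of_mem _ h)) A
    simp only [List.forall_mem_cons] at h3
    refine ⟨S', ?_, h7.trans h3.1, ?_, ?_⟩
    · rw [trials, h1, h4, h6]
    · simp only [List.forall_mem_cons]
      exact ⟨fun B hB => h7.trans (h3.2 B hB), h8⟩
    · rw [trials, h2, h5, List.length_cons, levels, List.length_map, List.length_range]
      have := Nat.mul_le_mul_right (Nat.log 2 n + 1) hlT
      linarith

/-- If some trial finds a point whose best level set is `ε`-optimal for the truncated problem,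
then the output is `ε`-optimal. -/
theorem minimizer_spec (hv : ∀ S, cost (O S ∅) = v S) (hmono : Monotone v) {P : Fin n → ℝ}
    (hP : P ∈ stdSimplex ℝ (Fin n)) (η : ℝ) (T : ℕ) (L : List (List ℝ))
    (hL : ∀ l ∈ L, (∀ θ ∈ l, 0 < θ) ∧ l.length ≤ T) :
    (minimizer P η L).calls O cost ≤ L.length * (T * (Nat.log 2 n + 1) + (n + 1)) + 1 ∧
      ∀ ε : ℝ, (∃ l ∈ L, ∀ S, levelMin (fun S => min (v S - v ∅) 1) P
        (iter (fun S => min (v S - v ∅) 1) P η l 0) ≤ min (v S - v ∅) 1 - ∑ i ∈ S, P i + ε) →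
      ∀ S, v ((minimizer P η L).run O cost) - ∑ i ∈ (minimizer P η L).run O cost, P i ≤
        v S - ∑ i ∈ S, P i + ε := by
  obtain ⟨S', h1, h2, h3, h4⟩ := trials_spec hv hmono P η T L hL ∅
  simp only [Finset.sum_empty, sub_zero] at h1 h2 h4
  simp only [minimizer, OracleAlg.run, OracleAlg.calls, hv, h1]
  refine ⟨by omega, ?_⟩
  rintro ε ⟨l, hl, hε⟩ S
  obtain ⟨k, hk, hmin⟩ := Finset.exists_mem_eq_inf' Finset.nonempty_range_add_one fun k =>
    min (v (prefixSet (descOrder (iter (fun S => min (v S - v ∅) 1) P η l 0)) k) - v ∅) 1 -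
      ∑ i ∈ prefixSet (descOrder (iter (fun S => min (v S - v ∅) 1) P η l 0)) k, P i
  have h5 := hε S
  rw [levelMin, hmin] at h5
  have h6 := h3 l hl _ (List.mem_map_of_mem (List.mem_range.2 (Finset.mem_range.1 hk)))
  set A := prefixSet (descOrder (iter (fun S => min (v S - v ∅) 1) P η l 0)) k
  have h7 : ∑ i ∈ A, P i ≤ 1 :=
    hP.2 ▸ Finset.sum_le_sum_of_subset_of_nonneg (Finset.subset_univ A) fun i _ _ => hP.1 i
  have h8 := min_le_left (v S - v ∅) 1
  -- If `A` is capped, its truncated value is at least 0 because `P` has mass at most 1 on `A`; then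
  -- `∅`, the initial candidate, is already good enough.
  rcases min_choice (v A - v ∅) 1 with h | h <;> rw [h] at h5 <;> linarith

end Spec


/-! ### The induced cost -/

theorem inducedCost_eq {X : Type u} {n : ℕ} {c : X → X → ℝ} {h : Fin n → Classifier X} {x z : X}
    {S : Finset (Fin n)} (hz : IsProjection c x (region h S ∅) z) :
    inducedCost c h x S = c x z := by
  refine IsLeast.csInf_eq ⟨⟨z, hz.1, rfl⟩, ?_⟩
  rintro _ ⟨z', hz', rfl⟩
  exact hz.2 z' hz'

/-- More classifiers leave a smaller region. Both the truncation and the binary search rely on this.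
-/
theorem IsVSubmodular.monotone {X : Type u} {n : ℕ} {c : X → X → ℝ} {h : Fin n → Classifier X}
    (hc : IsVSubmodular c h) (x : X) : Monotone (inducedCost c h x) := by
  intro S S' hS
  obtain ⟨z, hz⟩ := (hc x).1 S
  obtain ⟨z', hz'⟩ := (hc x).1 S'
  rw [inducedCost_eq hz, inducedCost_eq hz']
  exact hz.2 z' ⟨fun i hi => hz'.1.1 i (hS hi), hz'.1.2⟩

/-! ### Amplification by independent repetition -/

/-- If at most half of the seeds are bad, then `K` independent uniform seeds are all bad with
probability at most `2⁻ᴷ`. -/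
theorem toOuterMeasure_forall_mem_le {α : Type} [Fintype α] [Nonempty α] {B : Finset α}
    (hB : 2 * B.card ≤ Fintype.card α) {K : ℕ} {δ : ℝ} (hδ : 1 ≤ δ * 2 ^ K)
    {E : Set (Fin K → α)} (hE : ∀ s ∈ E, ∀ i, s i ∈ B) :
    (PMF.uniformOfFintype (Fin K → α)).toOuterMeasure E ≤ ENNReal.ofReal δ := by
  classical
  have hsub : E ⊆ (Fintype.piFinset fun _ : Fin K => B : Finset (Fin K → α)) := fun s hs =>
    Finset.mem_coe.2 (Fintype.mem_piFinset.2 (hE s hs))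
  refine (MeasureTheory.measure_mono hsub).trans ?_
  have hδ0 : 0 < δ := by
    by_contra hc
    have : (0 : ℝ) < 2 ^ K := by positivity
    nlinarith
  rw [PMF.toOuterMeasure_uniformOfFintype_apply]
  refine ENNReal.div_le_of_le_mul ?_
  simp only [Finset.coe_sort_coe, Fintype.card_coe, Fintype.card_piFinset_const, Fintype.card_fun,
    Fintype.card_fin]
  rw [← ENNReal.ofReal_natCast, ← ENNReal.ofReal_natCast, ← ENNReal.ofReal_mul hδ0.le]
  refine ENNReal.ofReal_le_ofReal ?_
  push_cast
  have h1 : (2 * B.card : ℝ) ≤ Fintype.card α := by exact_mod_cast hB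
  have h2 : (2 * B.card : ℝ) ^ K ≤ (Fintype.card α : ℝ) ^ K := pow_le_pow_left₀ (by positivity) h1 K
  rw [mul_pow] at h2
  have h3 : (0 : ℝ) ≤ (B.card : ℝ) ^ K := by positivity
  nlinarith

/-! ### The parameters -/

/-- The thresholds of one trial: a prefix of random length of a sequence of grid points. -/
noncomputable def thresholds {M T : ℕ} (s : (Fin T → Fin M) × Fin T) : List ℝ :=
  (List.ofFn fun t => grid (s.1 t)).take s.2

theorem thresholds_spec {M T : ℕ} (s : (Fin T → Fin M) × Fin T) :
    (∀ θ ∈ thresholds s, 0 < θ) ∧ (thresholds s).length ≤ T := by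
  refine ⟨fun θ hθ => ?_, by simp [thresholds]⟩
  obtain ⟨t, rfl⟩ := List.mem_ofFn.1 (List.mem_of_mem_take hθ)
  have : (0 : ℝ) < M := by exact_mod_cast (s.1 t).pos
  unfold grid
  positivity

/-- The number of independent trials. -/
noncomputable def trialCount (δ : ℝ) : ℕ := ⌈Real.log (2 / δ) / Real.log 2⌉₊

/-- The (maximal) number of steps of one trial. -/
noncomputable def stepCount (n : ℕ) (ε : ℝ) : ℕ := ⌈32 * n / ε ^ 2⌉₊ + 1

/-- The number of thresholds in the grid. -/
noncomputable def gridSize (n : ℕ) (ε : ℝ) : ℕ := ⌈8 * n / ε⌉₊ + 1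

/-- The random bits of one trial. -/
abbrev Seed (n : ℕ) (ε : ℝ) : Type :=
  (Fin (stepCount n ε) → Fin (gridSize n ε)) × Fin (stepCount n ε)

/-- The `+ 1` in `stepCount` and `gridSize` makes this hold for all parameters, as the uniform
distribution requires. -/
instance (n : ℕ) (ε : ℝ) : Nonempty (Seed n ε) :=
  ⟨fun _ => ⟨0, Nat.succ_pos _⟩, ⟨0, Nat.succ_pos _⟩⟩

open Classical in
/-- The randomized algorithm. -/
noncomputable def randomizedMinimizer (n : ℕ) (P : Fin n → ℝ) (ε δ : ℝ) : RandOracleAlg n :=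
  if 1 ≤ ε then PMF.pure (.output ∅)
  else (PMF.uniformOfFintype (Fin (trialCount δ) → Seed n ε)).map fun s =>
    minimizer P (ε / 8) (List.ofFn fun i => thresholds (s i))

theorem one_le_mul_two_pow_trialCount {δ : ℝ} (hδ : 0 < δ) : 1 ≤ δ * 2 ^ trialCount δ := by
  have h2 : 0 < Real.log 2 := Real.log_pos (by norm_num)
  have h1 : Real.log (2 / δ) ≤ trialCount δ * Real.log 2 := by
    rw [← div_le_iff₀ h2]
    exact Nat.le_ceil _
  rw [← Real.log_pow, Real.log_le_log_iff (by positivity) (by positivity),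
    div_le_iff₀ hδ] at h1
  linarith

theorem trialCount_le {δ : ℝ} (hδ : 0 < δ) (hδ1 : δ < 1) :
    (trialCount δ : ℝ) ≤ 3 * Real.log (2 / δ) := by
  have h2 : Real.log 2 ≤ Real.log (2 / δ) :=
    Real.log_le_log (by norm_num) (by rw [le_div_iff₀ hδ]; linarith)
  have h3 := Real.log_two_gt_d9
  have h0 : (0 : ℝ) < Real.log 2 := by linarith
  have h1 := (Nat.ceil_lt_add_one (a := Real.log (2 / δ) / Real.log 2)
    (div_nonneg (h0.le.trans h2) h0.le)).le
  refine h1.trans ?_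
  -- As `log (2 / δ) ≥ log 2`, the rounding term 1 is at most `log (2 / δ) / log 2`, and `2 / log 2
  -- < 3`.
  rw [← le_sub_iff_add_le, div_le_iff₀ h0]
  nlinarith

/-- The number of oracle calls in terms of the parameters. -/
theorem call_bound {n : ℕ} (hn : 0 < n) {ε δ : ℝ} (hε : 0 < ε) (hε1 : ε < 1) (hδ : 0 < δ)
    (hδ1 : δ < 1) :
    ((trialCount δ * (stepCount n ε * (Nat.log 2 n + 1) + (n + 1)) + 1 : ℕ) : ℝ) ≤
      314 * (n / ε ^ 2) * Real.log (2 + n / ε) ^ 1 * Real.log (2 / δ) := by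
  have hn' : (1 : ℝ) ≤ n := by exact_mod_cast hn
  have hlog2 := Real.log_two_gt_d9
  set q : ℝ := n / ε ^ 2 with hq
  set Λ : ℝ := Real.log (2 + n / ε) with hΛ
  set D : ℝ := Real.log (2 / δ) with hD
  have hnq : (n : ℝ) ≤ q := by
    rw [hq, le_div_iff₀ (by positivity)]
    have : ε ^ 2 ≤ 1 := pow_le_one₀ hε.le hε1.le
    nlinarith
  have hnε : (n : ℝ) ≤ n / ε := by
    rw [le_div_iff₀ hε]
    nlinarith
  have hΛ1 : 1 ≤ Λ := by
    rw [hΛ, Real.le_log_iff_exp_le (by positivity)]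
    have := Real.exp_one_lt_d9
    linarith
  have hD1 : Real.log 2 ≤ D :=
    Real.log_le_log (by norm_num) (by rw [le_div_iff₀ hδ]; linarith)
  have hK := trialCount_le hδ hδ1
  have hT : (stepCount n ε : ℝ) ≤ 34 * q := by
    have h1 := (Nat.ceil_lt_add_one (a := 32 * (n : ℝ) / ε ^ 2) (by positivity)).le
    rw [mul_div_assoc] at h1
    rw [stepCount, mul_div_assoc]
    push_cast
    linarith
  have hL : (Nat.log 2 n : ℝ) + 1 ≤ 3 * Λ := by
    have h1 := Real.natLog_le_logb n 2
    have h2 : Real.logb 2 n ≤ 2 * Λ := by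
      rw [Real.logb, div_le_iff₀ (by linarith)]
      have h3 : Real.log n ≤ Λ := Real.log_le_log (by linarith) (by linarith)
      nlinarith
    push_cast at h1
    linarith
  have hq0 : 0 < q := by linarith
  have hTL : (stepCount n ε : ℝ) * (Nat.log 2 n + 1) ≤ 34 * q * (3 * Λ) :=
    mul_le_mul hT hL (by positivity) (by positivity)
  have hqΛ : q ≤ q * Λ := le_mul_of_one_le_right hq0.le hΛ1
  -- `104 = 34 * 3 + 2`, with `n + 1 ≤ 2 * q`. Then `314 = 3 * 104 + 2`, the last 2 paying for the
  -- initial call at `∅`.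
  have hin : (stepCount n ε : ℝ) * (Nat.log 2 n + 1) + (n + 1) ≤ 104 * (q * Λ) := by linarith
  have hmul : (trialCount δ : ℝ) * (stepCount n ε * (Nat.log 2 n + 1) + (n + 1)) ≤
      3 * D * (104 * (q * Λ)) := mul_le_mul hK hin (by positivity) (by linarith)
  have h1 : 1 ≤ 2 * (q * Λ * D) := by
    have : 1 * (1 / 2) ≤ q * Λ * D :=
      mul_le_mul (by linarith) (by linarith) (by norm_num) (by positivity)
    linarith
  push_cast
  rw [pow_one]
  linarith

end StrategicOracle

open StrategicOracle in
theorem theorem3p4 :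
    -- absolute constants, and one algorithm whose inputs are `n`, the distribution `P`,
    -- the accuracy `ε` and the failure probability `δ`
    ∃ (C : ℝ) (k : ℕ) (alg : (n : ℕ) → (P : Fin n → ℝ) → (ε δ : ℝ) → RandOracleAlg n),
      ∀ (X : Type u) (H : Set (Classifier X)) (n : ℕ) (h : Fin n → Classifier X)
        (_ : Function.Injective h) (_ : ∀ i, h i ∈ H)
        (P : Fin n → ℝ) (_ : P ∈ stdSimplex ℝ (Fin n))
        (c : X → X → ℝ) (_ : ∀ x z, 0 ≤ c x z) (_ : IsVSubmodular c h)
        (x : X) (O : Finset (Fin n) → Finset (Fin n) → X) (_ : IsOracle c h x O)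
        (ε : ℝ) (_ : 0 < ε) (δ : ℝ) (_ : 0 < δ) (_ : δ < 1),
        -- every run makes `Õ(n / ε²)` oracle calls
        (∀ A ∈ (alg n P ε δ).support,
          (A.calls O (c x) : ℝ) ≤
            C * (n / ε ^ 2) * Real.log (2 + n / ε) ^ k * Real.log (2 / δ)) ∧
        -- with probability at least `1 - δ` the output is optimal up to `ε`
        (alg n P ε δ).toOuterMeasure
            {A | ¬ ∀ S : Finset (Fin n),
              objective P c h x S - ε ≤ objective P c h x (A.run O (c x))} ≤
          ENNReal.ofReal δ := by
  refine ⟨314, 1, randomizedMinimizer, ?_⟩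
  intro X _ n h _ _ P hP c _ hc x O hO ε hε δ hδ hδ1
  have hmono := hc.monotone x
  have hn : 0 < n := by
    rcases Nat.eq_zero_or_pos n with rfl | hn
    · exact absurd hP.2 (by simp)
    · exact hn
  have hv : ∀ S, c x (O S ∅) = inducedCost c h x S := fun S =>
    (inducedCost_eq (hO S ∅ ((hc x).1 S))).symm
  unfold randomizedMinimizer
  split_ifs with hε1
  -- For `ε ≥ 1` the set `∅` is good enough, since `P` has mass 1. Making no calls matters: the
  -- bound tends to 0 as `ε` grows.
  · refine ⟨fun A hA => ?_, ?_⟩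
    · rw [PMF.support_pure, Set.mem_singleton_iff] at hA
      have h1 : 0 ≤ Real.log (2 + n / ε) :=
        Real.log_nonneg (by linarith [show (0 : ℝ) ≤ n / ε by positivity])
      have h2 : 0 ≤ Real.log (2 / δ) := Real.log_nonneg (by rw [le_div_iff₀ hδ]; linarith)
      rw [hA, OracleAlg.calls, Nat.cast_zero]
      positivity
    · rw [PMF.toOuterMeasure_pure_apply, if_neg]
      · exact zero_le
      · simp only [Set.mem_ofPred_eq, not_not, OracleAlg.run, objective, Finset.sum_empty]
        intro S
        have h1 : ∑ i ∈ S, P i ≤ 1 :=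
          hP.2 ▸ Finset.sum_le_sum_of_subset_of_nonneg (Finset.subset_univ S) fun i _ _ => hP.1 i
        linarith [hmono (Finset.empty_subset S)]
  · have hspec := fun s : Fin (trialCount δ) → Seed n ε =>
      minimizer_spec (O := O) (cost := c x) hv hmono hP (ε / 8) (stepCount n ε)
        (List.ofFn fun i => thresholds (s i)) fun l hl => by
          obtain ⟨i, rfl⟩ := List.mem_ofFn.1 hl
          exact thresholds_spec _
    refine ⟨fun A hA => ?_, ?_⟩
    · obtain ⟨s, -, rfl⟩ := (PMF.mem_support_map_iff _ _ _).1 hA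
      refine le_trans ?_ (call_bound hn hε (not_le.1 hε1) hδ hδ1)
      have := (hspec s).1
      rw [List.length_ofFn] at this
      exact_mod_cast this
    · rw [PMF.toOuterMeasure_map_apply]
      have hM : 8 * n / ε ≤ gridSize n ε :=
        (Nat.le_ceil _).trans (Nat.cast_le.2 (Nat.le_succ _))
      have hT : 32 * n / ε ^ 2 ≤ stepCount n ε :=
        (Nat.le_ceil _).trans (Nat.cast_le.2 (Nat.le_succ _))
      -- The output fails only if every trial has a bad seed.
      refine toOuterMeasure_forall_mem_le (two_mul_card_bad_le
        (isUnitSubmodular_truncate hmono (hc x).2) hP hε hn hM hT)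
        (one_le_mul_two_pow_trialCount hδ) fun s hs i => ?_
      rw [Finset.mem_filter]
      refine ⟨Finset.mem_univ _, ?_⟩
      by_contra hcon
      push Not at hcon
      refine hs fun S => ?_
      have := (hspec s).2 ε ⟨thresholds (s i), List.mem_ofFn.2 ⟨i, rfl⟩, hcon⟩ S
      simp only [objective]
      linarith
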